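/- Let $X$ be an infinite set, and let $X'=\{x':x\in X\}$ be a disjoint copy of $X$. The partial Brauer monoid $\mathcal{PB}_X$ consists of all graphs with vertex set $X\cup X'$ in which every vertex has degree at most $1$. The product $\alpha\beta$ of $\alpha,\beta\in\mathcal{PB}_X$ is formed as follows: take a second disjoint copy $X''$ of $X$, rename each lower vertex $x'$ of $\alpha$ and each upper vertex $x$ of $\beta$ as $x''$, and let $\Pi(\alpha,\beta)$ be the graph on $X\cup X'\cup X''$ with all the edges of both renamed graphs; then two distinct vertices of $X\cup X'$ are joined by an edge in $\alpha\beta$ if and only if they lie in the same connected component of $\Pi(\alpha,\beta)$. The identity $1$ is the graph with edges $\{x,x'\}$ $(x\in X)$. For a subset $U$ of a semigroup $S$, let $\langle U\rangle$ be the subsemigroup generated by $U$, and for $A\subseteq S$ let $\operatorname{rank}(S:A)=\min\{|U| : U\subseteq S,\ S=\langle A\cup U\rangle\}$ be the relative rank of $S$ modulo $A$. Let $\mathcal E_X$ be the submonoid of $\mathcal{PB}_X$ generated by all idempotents. An element $\alpha\in\mathcal{PB}_X$ is a left unit if $\gamma\alpha=1$ for some $\gamma\in\mathcal{PB}_X$,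 and a right unit if $\alpha\gamma=1$ for some $\gamma\in\mathcal{PB}_X$. Let $\operatorname{def}(\alpha)$ be the number of $x\in X$ such that $\alpha$ has no edge of the form $\{x,y'\}$ with $y\in X$, and $\operatorname{codef}(\alpha)$ the number of $x\in X$ such that $\alpha$ has no edge of the form $\{y,x'\}$ with $y\in X$ (both are cardinals). Then: (i) $\operatorname{rank}(\mathcal{PB}_X:\mathcal E_X)=2$. (ii) For all $\alpha,\beta\in\mathcal{PB}_X$, we have $\mathcal{PB}_X=\langle\mathcal E_X\cup\{\alpha,\beta\}\rangle$ if and only if, after interchanging $\alpha$ and $\beta$ if necessary, $\alpha$ is a right unit, $\beta$ is a left unit, and $\operatorname{codef}(\alpha)=\operatorname{def}(\beta)=|X|$. -/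

import Mathlib

open Cardinal

universe u

/-! ## Generalities on semigroups and monoids -/

/-- The relative rank of a semigroup `S` modulo a subset `A`: the least cardinality of a subset
`U` such that `A ∪ U` generates `S` as a semigroup. -/
noncomputable def relRank (S : Type u) [Semigroup S] (A : Set S) : Cardinal.{u} :=
  sInf {c : Cardinal.{u} | ∃ U : Set S, Subsemigroup.closure (A ∪ U) = ⊤ ∧ #U = c}

/-- The subsemigroup generated by all idempotents. -/
def idempotentGenerated (S : Type u) [Semigroup S] : Subsemigroup S :=
  Subsemigroup.closure {e : S | IsIdempotentElem e}

/-- The set of left units: elements `x` with `a * x = 1` for some `a`. -/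
def leftUnits (M : Type u) [Monoid M] : Set M := {x : M | ∃ a : M, a * x = 1}

/-- The set of right units: elements `x` with `x * a = 1` for some `a`. -/
def rightUnits (M : Type u) [Monoid M] : Set M := {x : M | ∃ a : M, x * a = 1}

/-! ## Brauer graphs -/

/-- A Brauer graph on `X ∪ X'`: a graph in which every vertex has degree at most `1`.
The upper vertex `x` is `Sum.inl x`, the lower vertex `x'` is `Sum.inr x`. -/
@[ext]
structure PartialBrauer (X : Type u) where
  graph : SimpleGraph (X ⊕ X)
  eq_of_adj : ∀ u v w : X ⊕ X, graph.Adj u v → graph.Adj u w → v = w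

namespace PartialBrauer

variable {X : Type u}

/-- The vertices of product graphs, `X ∪ X' ∪ X''`: `Sum.inl` is used for the outer vertices
(those in `X ∪ X'`), and `Sum.inr x` is the middle vertex `x''`. -/
abbrev ProdVertex (X : Type u) : Type u := (X ⊕ X) ⊕ X

/-- The renaming of vertices with `x ↦ x`, `x' ↦ x''`. -/
def lowerToMiddle : X ⊕ X → ProdVertex X
  | Sum.inl x => Sum.inl (Sum.inl x)
  | Sum.inr x => Sum.inr x

/-- The renaming of vertices with `x ↦ x''`, `x' ↦ x'`. -/
def upperToMiddle : X ⊕ X → ProdVertex X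
  | Sum.inl x => Sum.inr x
  | Sum.inr x => Sum.inl (Sum.inr x)

/-- The product graph of `α` and `β`. Parallel edges are merged, which does not affect
connected components. -/
def prodGraph (α β : PartialBrauer X) : SimpleGraph (ProdVertex X) :=
  α.graph.map lowerToMiddle ⊔ β.graph.map upperToMiddle

theorem reachable_or_of_map {V W : Type u} {G : SimpleGraph V} {f : V → W}
    (hf : Function.Injective f) {w w' : W} (h : (G.map f).Reachable w w') :
    w = w' ∨ ∃ r r', w = f r ∧ w' = f r' ∧ G.Reachable r r' := by
  rw [SimpleGraph.reachable_iff_reflTransGen] at h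
  induction h with
  | refl => exact Or.inl rfl
  | tail _ hs ih =>
    obtain ⟨_, a, b, hab, rfl, rfl⟩ := hs
    rcases ih with rfl | ⟨r, r', rfl, h2, h3⟩
    · exact Or.inr ⟨a, b, rfl, rfl, hab.reachable⟩
    · obtain rfl := hf h2
      exact Or.inr ⟨r, b, rfl, rfl, h3.trans hab.reachable⟩

theorem reachable_map {V W : Type u} {G : SimpleGraph V} {H : SimpleGraph W} {f : V → W}
    (hf : ∀ a b, G.Adj a b → H.Reachable (f a) (f b)) {r r' : V} (h : G.Reachable r r') :
    H.Reachable (f r) (f r') := by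
  rw [SimpleGraph.reachable_iff_reflTransGen] at h
  induction h with
  | refl => exact SimpleGraph.Reachable.refl _
  | tail _ hs ih => exact ih.trans (hf _ _ hs)

theorem reachable_of_contract {V W : Type u} {P : SimpleGraph V} {A B : SimpleGraph W} {e : V → W}
    (hA : ∀ p q, A.Reachable (e p) (e q) → P.Reachable p q)
    (hB : ∀ w w', B.Adj w w' → ∃ p q, w = e p ∧ w' = e q ∧ P.Reachable p q)
    {p q : V} (h : (A ⊔ B).Reachable (e p) (e q)) : P.Reachable p q := by
  have key : ∀ w, (A ⊔ B).Reachable (e p) w → ∃ s, P.Reachable p s ∧ A.Reachable (e s) w := by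
    intro w hw
    rw [SimpleGraph.reachable_iff_reflTransGen] at hw
    induction hw with
    | refl => exact ⟨p, SimpleGraph.Reachable.refl _, SimpleGraph.Reachable.refl _⟩
    | tail _ hs ih =>
      obtain ⟨s, h1, h2⟩ := ih
      rcases hs with hs | hs
      · exact ⟨s, h1, h2.trans hs.reachable⟩
      · obtain ⟨a, b, rfl, rfl, hab⟩ := hB _ _ hs
        exact ⟨b, (h1.trans (hA _ _ h2)).trans hab, SimpleGraph.Reachable.refl _⟩
  obtain ⟨s, h1, h2⟩ := key _ h
  exact h1.trans (hA _ _ h2)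

/-- In a graph of maximum degree at most `2`, the end-point of a path that runs from a given vertex,
does not start towards a given neighbour, and ends in a vertex of degree at most `1`, is unique. -/
theorem path_end_unique {V : Type u} {G : SimpleGraph V}
    (h2 : ∀ v a b c, G.Adj v a → G.Adj v b → G.Adj v c → a = b ∨ a = c ∨ b = c)
    {y z : V} (hy : ∀ a b, G.Adj y a → G.Adj y b → a = b)
    (hz : ∀ a b, G.Adj z a → G.Adj z b → a = b)
    {u : V} (p : G.Walk u y) : ∀ (q : G.Walk u z) (t : V), p.IsPath → q.IsPath →
      G.Adj u t → t ∉ p.support → t ∉ q.support → y = z := by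
  induction p with
  | nil =>
    intro q t _ _ ht _ hq
    cases q with
    | nil => rfl
    | cons h q' =>
      exfalso
      obtain rfl := hy _ _ ht h
      simp at hq
  | @cons u v y h p' ih =>
    intro q t hp hq ht htp htq
    cases q with
    | nil =>
      exfalso
      obtain rfl := hz _ _ ht h
      simp at htp
    | @cons _ w _ h' q' =>
      have hv : v = w := by
        rcases h2 u t v w ht h h' with rfl | rfl | rfl
        · simp at htp
        · simp at htq
        · rfl
      subst hv
      rw [SimpleGraph.Walk.cons_isPath_iff] at hp hq
      exact ih hy q' u hp.1 hq.1 h.symm hp.2 hq.2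

theorem eq_of_reachable_ends {V : Type u} {G : SimpleGraph V}
    (h2 : ∀ v a b c, G.Adj v a → G.Adj v b → G.Adj v c → a = b ∨ a = c ∨ b = c)
    {u y z : V} (hu : ∀ a b, G.Adj u a → G.Adj u b → a = b)
    (hy : ∀ a b, G.Adj y a → G.Adj y b → a = b)
    (hz : ∀ a b, G.Adj z a → G.Adj z b → a = b)
    (huy : u ≠ y) (huz : u ≠ z) (h : G.Reachable u y) (h' : G.Reachable u z) : y = z := by
  obtain ⟨p, hp⟩ := h.exists_isPath
  obtain ⟨q, hq⟩ := h'.exists_isPath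
  cases p with
  | nil => exact absurd rfl huy
  | cons a p =>
    cases q with
    | nil => exact absurd rfl huz
    | cons b q =>
      obtain rfl := hu _ _ a b
      rw [SimpleGraph.Walk.cons_isPath_iff] at hp hq
      exact path_end_unique h2 hy hz p q u hp.1 hq.1 a.symm hp.2 hq.2

theorem lowerToMiddle_injective : Function.Injective (lowerToMiddle (X := X)) := by
  rintro (x | x) (y | y) h <;> simp_all [lowerToMiddle]

theorem upperToMiddle_injective : Function.Injective (upperToMiddle (X := X)) := by
  rintro (x | x) (y | y) h <;> simp_all [upperToMiddle]

theorem eq_of_map_adj (α : PartialBrauer X) {W : Type u} {f : X ⊕ X → W}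
    (hf : Function.Injective f) {p q r : W}
    (h : (α.graph.map f).Adj p q) (h' : (α.graph.map f).Adj p r) : q = r := by
  obtain ⟨_, a, b, hab, rfl, rfl⟩ := h
  obtain ⟨_, c, d, hcd, h3, rfl⟩ := h'
  obtain rfl := hf h3
  rw [α.eq_of_adj _ _ _ hab hcd]

theorem prodGraph_degree_le_two (α β : PartialBrauer X) (v a b c : ProdVertex X)
    (ha : (prodGraph α β).Adj v a) (hb : (prodGraph α β).Adj v b) (hc : (prodGraph α β).Adj v c) :
    a = b ∨ a = c ∨ b = c := by
  rcases ha with ha | ha <;> rcases hb with hb | hb <;> rcases hc with hc | hc <;>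
    first
    | exact Or.inl (eq_of_map_adj _ lowerToMiddle_injective ha hb)
    | exact Or.inl (eq_of_map_adj _ upperToMiddle_injective ha hb)
    | exact Or.inr (Or.inl (eq_of_map_adj _ lowerToMiddle_injective ha hc))
    | exact Or.inr (Or.inl (eq_of_map_adj _ upperToMiddle_injective ha hc))
    | exact Or.inr (Or.inr (eq_of_map_adj _ lowerToMiddle_injective hb hc))
    | exact Or.inr (Or.inr (eq_of_map_adj _ upperToMiddle_injective hb hc))

theorem prodGraph_outer_degree_le_one (α β : PartialBrauer X) (u : X ⊕ X) (a b : ProdVertex X)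
    (ha : (prodGraph α β).Adj (Sum.inl u) a) (hb : (prodGraph α β).Adj (Sum.inl u) b) : a = b := by
  rcases ha with ha | ha <;> rcases hb with hb | hb
  · exact eq_of_map_adj _ lowerToMiddle_injective ha hb
  · obtain ⟨_, r | r, _, _, h1, _⟩ := ha <;> obtain ⟨_, s | s, _, _, h2, _⟩ := hb <;>
      simp [lowerToMiddle, upperToMiddle] at h1 h2
    rw [← h1] at h2
    simp at h2
  · obtain ⟨_, r | r, _, _, h1, _⟩ := ha <;> obtain ⟨_, s | s, _, _, h2, _⟩ := hb <;>
      simp [lowerToMiddle, upperToMiddle] at h1 h2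
    rw [← h1] at h2
    simp at h2
  · exact eq_of_map_adj _ upperToMiddle_injective ha hb

/-- The product of Brauer graphs: there is an edge between two distinct outer vertices exactly
when they lie in the same connected component of the product graph. -/
instance : Mul (PartialBrauer X) where
  mul α β :=
    { graph :=
        { Adj := fun u v => u ≠ v ∧ (prodGraph α β).Reachable (Sum.inl u) (Sum.inl v)
          symm := ⟨fun _ _ h => ⟨h.1.symm, h.2.symm⟩⟩
          loopless := ⟨fun _ h => h.1 rfl⟩ }
      eq_of_adj := fun u v w huv huw => Sum.inl_injective
        (eq_of_reachable_ends (prodGraph_degree_le_two α β) (prodGraph_outer_degree_le_one α β u)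
          (prodGraph_outer_degree_le_one α β v) (prodGraph_outer_degree_le_one α β w)
          (fun h => huv.1 (Sum.inl_injective h)) (fun h => huw.1 (Sum.inl_injective h))
          huv.2 huw.2) }

/-- The identity is the Brauer graph with edges `{x, x'}` for `x` in `X`. -/
instance : One (PartialBrauer X) where
  one :=
    { graph :=
        { Adj := fun u v => ∃ x : X, (u = Sum.inl x ∧ v = Sum.inr x) ∨ (u = Sum.inr x ∧ v = Sum.inl x)
          symm := ⟨fun _ _ ⟨x, h⟩ => ⟨x, h.symm.imp And.symm And.symm⟩⟩
          loopless := ⟨by rintro _ ⟨x, ⟨rfl, h⟩ | ⟨rfl, h⟩⟩ <;> simp at h⟩ }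
      eq_of_adj := by
        rintro u v w ⟨x, ⟨rfl, rfl⟩ | ⟨rfl, rfl⟩⟩ ⟨y, ⟨h, rfl⟩ | ⟨h, rfl⟩⟩ <;> simp_all }

theorem mul_adj (α β : PartialBrauer X) (u v : X ⊕ X) : (α * β).graph.Adj u v ↔
    u ≠ v ∧ (prodGraph α β).Reachable (Sum.inl u) (Sum.inl v) := Iff.rfl

theorem one_adj (u v : X ⊕ X) : (1 : PartialBrauer X).graph.Adj u v ↔
    ∃ x : X, (u = Sum.inl x ∧ v = Sum.inr x) ∨ (u = Sum.inr x ∧ v = Sum.inl x) := Iff.rfl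

theorem reachable_mul {α β : PartialBrauer X} {u v : X ⊕ X}
    {P : SimpleGraph (ProdVertex X)} {f : X ⊕ X → ProdVertex X}
    (hP : ∀ u v, ((α * β).graph.map f).Adj u v → P.Adj u v) (hf : Function.Injective f)
    (h : (prodGraph α β).Reachable (Sum.inl u) (Sum.inl v)) : P.Reachable (f u) (f v) := by
  by_cases huv : u = v
  · rw [huv]
  · exact (hP _ _ ⟨fun h => huv (hf h), u, v, (mul_adj α β u v).2 ⟨huv, h⟩, rfl, rfl⟩).reachable

/-- An edge of a Brauer graph joins any two distinct connected vertices. -/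
theorem adj_of_reachable (α : PartialBrauer X) {u v : X ⊕ X} (h : α.graph.Reachable u v)
    (huv : u ≠ v) : α.graph.Adj u v := by
  obtain ⟨p, hp⟩ := h.exists_isPath
  cases p with
  | nil => exact absurd rfl huv
  | cons a p =>
    cases p with
    | nil => exact a
    | cons b p =>
      obtain rfl := α.eq_of_adj _ _ _ a.symm b
      rw [SimpleGraph.Walk.cons_isPath_iff] at hp
      simp at hp

theorem one_mul' (α : PartialBrauer X) : 1 * α = α := by
  ext u v
  rw [mul_adj]
  constructor
  · rintro ⟨huv, h⟩
    refine adj_of_reachable α ?_ huv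
    refine reachable_map (f := Sum.elim id Sum.inl) (H := α.graph) ?_ h
    rintro a b (⟨_, c, d, h, rfl, rfl⟩ | ⟨_, c, d, h, rfl, rfl⟩)
    · obtain ⟨x, ⟨rfl, rfl⟩ | ⟨rfl, rfl⟩⟩ := h <;> exact SimpleGraph.Reachable.refl _
    · rcases c with c | c <;> rcases d with d | d <;> exact h.reachable
  · intro h
    refine ⟨h.ne, ?_⟩
    have key : ∀ w : X ⊕ X, (prodGraph 1 α).Reachable (Sum.inl w) (upperToMiddle w) := by
      rintro (x | x)
      · refine SimpleGraph.Adj.reachable (Or.inl ⟨by simp [upperToMiddle], Sum.inl x, Sum.inr x,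
          ⟨x, Or.inl ⟨rfl, rfl⟩⟩, rfl, rfl⟩)
      · exact SimpleGraph.Reachable.refl _
    refine ((key u).trans (SimpleGraph.Adj.reachable (Or.inr ?_))).trans (key v).symm
    exact ⟨fun e => h.ne (upperToMiddle_injective e), u, v, h, rfl, rfl⟩

theorem mul_one' (α : PartialBrauer X) : α * 1 = α := by
  ext u v
  rw [mul_adj]
  constructor
  · rintro ⟨huv, h⟩
    refine adj_of_reachable α ?_ huv
    refine reachable_map (f := Sum.elim id Sum.inr) (H := α.graph) ?_ h
    rintro a b (⟨_, c, d, h, rfl, rfl⟩ | ⟨_, c, d, h, rfl, rfl⟩)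
    · rcases c with c | c <;> rcases d with d | d <;> exact h.reachable
    · obtain ⟨x, ⟨rfl, rfl⟩ | ⟨rfl, rfl⟩⟩ := h <;> exact SimpleGraph.Reachable.refl _
  · intro h
    refine ⟨h.ne, ?_⟩
    have key : ∀ w : X ⊕ X, (prodGraph α 1).Reachable (Sum.inl w) (lowerToMiddle w) := by
      rintro (x | x)
      · exact SimpleGraph.Reachable.refl _
      · refine SimpleGraph.Adj.reachable (Or.inr ⟨by simp [lowerToMiddle], Sum.inr x, Sum.inl x,
          ⟨x, Or.inr ⟨rfl, rfl⟩⟩, rfl, rfl⟩)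
    refine ((key u).trans (SimpleGraph.Adj.reachable (Or.inl ?_))).trans (key v).symm
    exact ⟨fun e => h.ne (lowerToMiddle_injective e), u, v, h, rfl, rfl⟩

/-- The graph on four rows of vertices (two outer, two middle) associated to three factors. -/
def tripleGraph (α β γ : PartialBrauer X) : SimpleGraph ((X ⊕ X) ⊕ (X ⊕ X)) :=
  α.graph.map (Sum.map Sum.inl Sum.inl) ⊔ β.graph.map Sum.inr ⊔
    γ.graph.map (Sum.elim (Sum.inr ∘ Sum.inr) (Sum.inl ∘ Sum.inr))

theorem reachable_left (α β γ : PartialBrauer X) (u v : X ⊕ X) :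
    (prodGraph (α * β) γ).Reachable (Sum.inl u) (Sum.inl v) ↔
      (tripleGraph α β γ).Reachable (Sum.inl u) (Sum.inl v) := by
  let e : ProdVertex X → (X ⊕ X) ⊕ (X ⊕ X) := Sum.map id Sum.inr
  let f : ProdVertex X → (X ⊕ X) ⊕ (X ⊕ X) :=
    Sum.elim (Sum.map Sum.inl Sum.inr) (Sum.inr ∘ Sum.inl)
  have he : ∀ w, e (lowerToMiddle w) = f (Sum.inl w) := by rintro (x | x) <;> rfl
  have hf : Function.Injective f := by
    rintro ((x | x) | x) ((y | y) | y) h <;> simp_all [f]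
  have hei : Function.Injective e := by
    rintro ((x | x) | x) ((y | y) | y) h <;> simp_all [e]
  have hsup : tripleGraph α β γ = (prodGraph α β).map f ⊔
      γ.graph.map (Sum.elim (Sum.inr ∘ Sum.inr) (Sum.inl ∘ Sum.inr)) := by
    unfold tripleGraph
    congr 1
    ext w w'
    constructor
    · rintro (⟨hne, a, b, h, rfl, rfl⟩ | ⟨hne, a, b, h, rfl, rfl⟩)
      · refine ⟨hne, lowerToMiddle a, lowerToMiddle b,
          Or.inl ⟨fun e => h.ne (lowerToMiddle_injective e), a, b, h, rfl, rfl⟩, ?_, ?_⟩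
        · rcases a with a | a <;> rfl
        · rcases b with b | b <;> rfl
      · refine ⟨hne, upperToMiddle a, upperToMiddle b,
          Or.inr ⟨fun e => h.ne (upperToMiddle_injective e), a, b, h, rfl, rfl⟩, ?_, ?_⟩
        · rcases a with a | a <;> rfl
        · rcases b with b | b <;> rfl
    · rintro ⟨hne, _, _, (⟨_, a, b, h, rfl, rfl⟩ | ⟨_, a, b, h, rfl, rfl⟩), rfl, rfl⟩
      · refine Or.inl ⟨hne, a, b, h, ?_, ?_⟩
        · rcases a with a | a <;> rfl
        · rcases b with b | b <;> rfl
      · refine Or.inr ⟨hne, a, b, h, ?_, ?_⟩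
        · rcases a with a | a <;> rfl
        · rcases b with b | b <;> rfl
  rw [hsup]
  constructor
  · refine reachable_map (f := e) ?_
    rintro _ _ (⟨_, a, b, h, rfl, rfl⟩ | ⟨_, a, b, h, rfl, rfl⟩)
    · rw [he, he]
      refine reachable_map (f := f) ?_ h.2
      intro c d hcd
      exact SimpleGraph.Adj.reachable (Or.inl ⟨fun e => hcd.ne (hf e), c, d, hcd, rfl, rfl⟩)
    · refine SimpleGraph.Adj.reachable (Or.inr ⟨?_, a, b, h, ?_, ?_⟩)
      · exact fun e => h.ne (upperToMiddle_injective (hei e))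
      · rcases a with a | a <;> rfl
      · rcases b with b | b <;> rfl
  · refine reachable_of_contract (e := e) (p := Sum.inl u) (q := Sum.inl v) ?_ ?_
    · intro p q h
      rcases reachable_or_of_map hf h with h | ⟨r, r', h1, h2, h3⟩
      · rw [hei h]
      · have aux : ∀ p r, e p = f r → ∃ w, p = lowerToMiddle w ∧ r = Sum.inl w := by
          rintro ((x | x) | x) ((y | y) | y) h <;> simp_all [e, f, lowerToMiddle]
        obtain ⟨w, rfl, rfl⟩ := aux _ _ h1
        obtain ⟨w', rfl, rfl⟩ := aux _ _ h2
        exact reachable_mul (fun _ _ h => Or.inl h) lowerToMiddle_injective h3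
    · rintro _ _ ⟨_, a, b, h, rfl, rfl⟩
      refine ⟨upperToMiddle a, upperToMiddle b, ?_, ?_, SimpleGraph.Adj.reachable (Or.inr
        ⟨fun e => h.ne (upperToMiddle_injective e), a, b, h, rfl, rfl⟩)⟩
      · rcases a with a | a <;> rfl
      · rcases b with b | b <;> rfl

theorem reachable_right (α β γ : PartialBrauer X) (u v : X ⊕ X) :
    (prodGraph α (β * γ)).Reachable (Sum.inl u) (Sum.inl v) ↔
      (tripleGraph α β γ).Reachable (Sum.inl u) (Sum.inl v) := by
  let e : ProdVertex X → (X ⊕ X) ⊕ (X ⊕ X) := Sum.map id Sum.inl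
  let f : ProdVertex X → (X ⊕ X) ⊕ (X ⊕ X) :=
    Sum.elim (Sum.elim (Sum.inr ∘ Sum.inl) (Sum.inl ∘ Sum.inr)) (Sum.inr ∘ Sum.inr)
  have he : ∀ w, e (upperToMiddle w) = f (Sum.inl w) := by rintro (x | x) <;> rfl
  have hf : Function.Injective f := by
    rintro ((x | x) | x) ((y | y) | y) h <;> simp_all [f]
  have hei : Function.Injective e := by
    rintro ((x | x) | x) ((y | y) | y) h <;> simp_all [e]
  have hsup : tripleGraph α β γ = (prodGraph β γ).map f ⊔
      α.graph.map (Sum.map Sum.inl Sum.inl) := by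
    unfold tripleGraph
    rw [sup_assoc, sup_comm]
    congr 1
    ext w w'
    constructor
    · rintro (⟨hne, a, b, h, rfl, rfl⟩ | ⟨hne, a, b, h, rfl, rfl⟩)
      · refine ⟨hne, lowerToMiddle a, lowerToMiddle b,
          Or.inl ⟨fun e => h.ne (lowerToMiddle_injective e), a, b, h, rfl, rfl⟩, ?_, ?_⟩
        · rcases a with a | a <;> rfl
        · rcases b with b | b <;> rfl
      · refine ⟨hne, upperToMiddle a, upperToMiddle b,
          Or.inr ⟨fun e => h.ne (upperToMiddle_injective e), a, b, h, rfl, rfl⟩, ?_, ?_⟩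
        · rcases a with a | a <;> rfl
        · rcases b with b | b <;> rfl
    · rintro ⟨hne, _, _, (⟨_, a, b, h, rfl, rfl⟩ | ⟨_, a, b, h, rfl, rfl⟩), rfl, rfl⟩
      · refine Or.inl ⟨hne, a, b, h, ?_, ?_⟩
        · rcases a with a | a <;> rfl
        · rcases b with b | b <;> rfl
      · refine Or.inr ⟨hne, a, b, h, ?_, ?_⟩
        · rcases a with a | a <;> rfl
        · rcases b with b | b <;> rfl
  rw [hsup]
  constructor
  · refine reachable_map (f := e) ?_
    rintro _ _ (⟨_, a, b, h, rfl, rfl⟩ | ⟨_, a, b, h, rfl, rfl⟩)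
    · refine SimpleGraph.Adj.reachable (Or.inr ⟨?_, a, b, h, ?_, ?_⟩)
      · exact fun e => h.ne (lowerToMiddle_injective (hei e))
      · rcases a with a | a <;> rfl
      · rcases b with b | b <;> rfl
    · rw [he, he]
      refine reachable_map (f := f) ?_ h.2
      intro c d hcd
      exact SimpleGraph.Adj.reachable (Or.inl ⟨fun e => hcd.ne (hf e), c, d, hcd, rfl, rfl⟩)
  · refine reachable_of_contract (e := e) (p := Sum.inl u) (q := Sum.inl v) ?_ ?_
    · intro p q h
      rcases reachable_or_of_map hf h with h | ⟨r, r', h1, h2, h3⟩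
      · rw [hei h]
      · have aux : ∀ p r, e p = f r → ∃ w, p = upperToMiddle w ∧ r = Sum.inl w := by
          rintro ((x | x) | x) ((y | y) | y) h <;> simp_all [e, f, upperToMiddle]
        obtain ⟨w, rfl, rfl⟩ := aux _ _ h1
        obtain ⟨w', rfl, rfl⟩ := aux _ _ h2
        exact reachable_mul (fun _ _ h => Or.inr h) upperToMiddle_injective h3
    · rintro _ _ ⟨_, a, b, h, rfl, rfl⟩
      refine ⟨lowerToMiddle a, lowerToMiddle b, ?_, ?_, SimpleGraph.Adj.reachable (Or.inl
        ⟨fun e => h.ne (lowerToMiddle_injective e), a, b, h, rfl, rfl⟩)⟩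
      · rcases a with a | a <;> rfl
      · rcases b with b | b <;> rfl

/-- The partial Brauer monoid. -/
instance : Monoid (PartialBrauer X) where
  mul_assoc α β γ := by
    ext u v
    rw [mul_adj, mul_adj, reachable_left, reachable_right]
  one_mul := one_mul'
  mul_one := mul_one'

/-! ## Parameters -/

/-- The domain of `α`: those `x` such that `x` belongs to a transversal `{x, y'}`. -/
def dom (α : PartialBrauer X) : Set X := {x | ∃ y : X, α.graph.Adj (Sum.inl x) (Sum.inr y)}

/-- The codomain of `α`: those `x` such that `x'` belongs to a transversal `{y, x'}`. -/
def codom (α : PartialBrauer X) : Set X := {x | ∃ y : X, α.graph.Adj (Sum.inl y) (Sum.inr x)}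

/-- The defect of `α`, the cardinality of `X \ dom α`. -/
noncomputable def defect (α : PartialBrauer X) : Cardinal.{u} := #((dom α)ᶜ : Set X)

/-- The codefect of `α`, the cardinality of `X \ codom α`. -/
noncomputable def codefect (α : PartialBrauer X) : Cardinal.{u} := #((codom α)ᶜ : Set X)

end PartialBrauer

/-!
Write `κ = #X`. Reflecting graphs interchanges left and right units, so one side of each argument
suffices.

*Generation.* A right unit `α` has domain `X`, and multiplying it by the partial identity on its
codomain leaves exactly the transversals `{x, (f x)'}` of an injection `f`; a left unit `β` gives
the transversals `{g x, x'}` in the same way. Any `γ` is (upper hooks) * (transversals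
`{s i, (h i)'}`) * (lower hooks), where the outer factors are idempotents, and the middle one is
`f` followed by the transversals `{f (s i), (g (h i))'}` followed by the inverse of `g`. If
`codef α = def β = κ`, then `f ∘ s` and `g ∘ h` miss `κ` points, and transversals of this kind are
products of idempotents (`transversals_mem`): with room for two further disjoint copies of the
index set, hooks move one copy to another (`transversals_mem_of_disjoint`).

*Necessity.* Take a right unit of codefect `κ` and consider the partial products of a
factorization, all of which are right units. If `r` and `r * x` are right units, then
`def x ≤ codef r + codef r` and `codef (r * x) ≤ codef x + codef r`. Idempotents have equal defect
and codefect, so the factor at which the codefect reaches `κ` is a generator with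
`def x < κ = codef x`. Dually there is a generator with `codef y < κ = def y`. Moreover the first
factor different from `1` is a right unit, and an idempotent right unit is `1`, so some generator is
a right unit, and dually some generator is a left unit. Comparing defects shows which of `α` and
`β` is which. The relative rank is then `2`, since one generator `α` would be the pair `α, α`,
making `α` both a left unit and of codefect `κ`.
-/

namespace PartialBrauer

variable {X : Type u}

/-! ### Edges of a product -/

/-- Brauer graphs are determined by their upper hooks, transversals and lower hooks. -/
theorem ext_hooks {α β : PartialBrauer X}
    (hU : ∀ x y, α.graph.Adj (Sum.inl x) (Sum.inl y) ↔ β.graph.Adj (Sum.inl x) (Sum.inl y))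
    (hT : ∀ x y, α.graph.Adj (Sum.inl x) (Sum.inr y) ↔ β.graph.Adj (Sum.inl x) (Sum.inr y))
    (hL : ∀ x y, α.graph.Adj (Sum.inr x) (Sum.inr y) ↔ β.graph.Adj (Sum.inr x) (Sum.inr y)) :
    α = β := by
  ext u v
  rcases u with x | x <;> rcases v with y | y
  · exact hU x y
  · exact hT x y
  · rw [SimpleGraph.adj_comm, hT, SimpleGraph.adj_comm]
  · exact hL x y

/-- A Brauer graph containing another one, all of whose vertices of degree `1` have degree `1` in
the smaller graph, is equal to it. -/
theorem eq_of_le_of_forall_exists_adj {α β : PartialBrauer X}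
    (hle : ∀ u v, β.graph.Adj u v → α.graph.Adj u v)
    (hex : ∀ u v, α.graph.Adj u v → ∃ w, β.graph.Adj u w) : α = β := by
  ext u v
  refine ⟨fun h => ?_, hle u v⟩
  obtain ⟨w, hw⟩ := hex u v h
  rwa [α.eq_of_adj _ _ _ h (hle _ _ hw)]

theorem prodGraph_adj_left (β : PartialBrauer X) {α : PartialBrauer X} {u v : X ⊕ X}
    (h : α.graph.Adj u v) : (prodGraph α β).Adj (lowerToMiddle u) (lowerToMiddle v) :=
  Or.inl ⟨fun e => h.ne (lowerToMiddle_injective e), u, v, h, rfl, rfl⟩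

theorem prodGraph_adj_right (α : PartialBrauer X) {β : PartialBrauer X} {u v : X ⊕ X}
    (h : β.graph.Adj u v) : (prodGraph α β).Adj (upperToMiddle u) (upperToMiddle v) :=
  Or.inr ⟨fun e => h.ne (upperToMiddle_injective e), u, v, h, rfl, rfl⟩

/-- A set of vertices that is closed under adjacency contains the component of each of its
elements. -/
theorem mem_of_reachable {V : Type u} {G : SimpleGraph V} {S : Set V}
    (hS : ∀ a b, a ∈ S → G.Adj a b → b ∈ S) {a b : V} (ha : a ∈ S) (h : G.Reachable a b) :
    b ∈ S := by
  rw [SimpleGraph.reachable_iff_reflTransGen] at h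
  induction h with
  | refl => exact ha
  | tail _ hs ih => exact hS _ _ ih hs

theorem mul_adj_upper {α : PartialBrauer X} (β : PartialBrauer X) {x y : X}
    (h : α.graph.Adj (Sum.inl x) (Sum.inl y)) :
    (α * β).graph.Adj (Sum.inl x) (Sum.inl y) :=
  ⟨h.ne, (prodGraph_adj_left β h).reachable⟩

theorem mul_adj_lower (α : PartialBrauer X) {β : PartialBrauer X} {x y : X}
    (h : β.graph.Adj (Sum.inr x) (Sum.inr y)) :
    (α * β).graph.Adj (Sum.inr x) (Sum.inr y) :=
  ⟨h.ne, (prodGraph_adj_right α h).reachable⟩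

theorem mul_adj_transversal {α β : PartialBrauer X} {x y z : X}
    (h : α.graph.Adj (Sum.inl x) (Sum.inr y)) (h' : β.graph.Adj (Sum.inl y) (Sum.inr z)) :
    (α * β).graph.Adj (Sum.inl x) (Sum.inr z) :=
  ⟨by simp, (prodGraph_adj_left β h).reachable.trans (prodGraph_adj_right α h').reachable⟩

/-- Two transversals of `α` whose lower ends are joined by an upper hook of `β` become an upper
hook of `α * β`. -/
theorem mul_adj_upper_of_hook {α β : PartialBrauer X} {x y y' x' : X}
    (h : α.graph.Adj (Sum.inl x) (Sum.inr y)) (hy : β.graph.Adj (Sum.inl y) (Sum.inl y'))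
    (h' : α.graph.Adj (Sum.inl x') (Sum.inr y')) :
    (α * β).graph.Adj (Sum.inl x) (Sum.inl x') := by
  refine ⟨?_, ((prodGraph_adj_left β h).reachable.trans
    (prodGraph_adj_right α hy).reachable).trans (prodGraph_adj_left β h').symm.reachable⟩
  intro e
  obtain rfl := Sum.inl_injective e
  exact hy.ne (congrArg Sum.inl (Sum.inr_injective (α.eq_of_adj _ _ _ h h')))

theorem exists_adj_of_mul_adj_upper {α β : PartialBrauer X} {x : X} {v : X ⊕ X}
    (h : (α * β).graph.Adj (Sum.inl x) v) : ∃ w, α.graph.Adj (Sum.inl x) w := by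
  by_contra! hn
  have := mem_of_reachable (S := {Sum.inl (Sum.inl x)}) ?_ rfl h.2
  · exact h.1 (Sum.inl_injective this).symm
  · rintro a b rfl (⟨_, c, d, hcd, h1, rfl⟩ | ⟨_, c, d, hcd, h1, rfl⟩)
    · obtain rfl := lowerToMiddle_injective (a₂ := Sum.inl x) h1
      exact absurd hcd (hn d)
    · rcases c with c | c <;> simp [upperToMiddle] at h1

/-- If the transversal `{x, y'}` of `α` ends at a vertex isolated in `β`, then `x` is isolated in
`α * β`. -/
theorem exists_adj_of_mul_adj_of_adj {α β : PartialBrauer X} {x y : X} {v : X ⊕ X}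
    (h : (α * β).graph.Adj (Sum.inl x) v) (hxy : α.graph.Adj (Sum.inl x) (Sum.inr y)) :
    ∃ w, β.graph.Adj (Sum.inl y) w := by
  by_contra! hn
  have := mem_of_reachable (S := {Sum.inl (Sum.inl x), Sum.inr y}) ?_ (Or.inl rfl) h.2
  · rcases this with this | this
    · exact h.1 (Sum.inl_injective this).symm
    · simp at this
  · rintro a b (rfl | rfl) (⟨_, c, d, hcd, h1, rfl⟩ | ⟨_, c, d, hcd, h1, rfl⟩)
    · obtain rfl := lowerToMiddle_injective (a₂ := Sum.inl x) h1
      obtain rfl := α.eq_of_adj _ _ _ hcd hxy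
      exact Or.inr rfl
    · rcases c with c | c <;> simp [upperToMiddle] at h1
    · obtain rfl := lowerToMiddle_injective (a₂ := Sum.inr y) h1
      obtain rfl := α.eq_of_adj _ _ _ hcd hxy.symm
      exact Or.inl rfl
    · obtain rfl := upperToMiddle_injective (a₂ := Sum.inl y) h1
      exact absurd hcd (hn d)

/-! ### The involution -/

/-- The reflection of a Brauer graph in a horizontal axis, which interchanges `x` and `x'`. -/
def flip (α : PartialBrauer X) : PartialBrauer X where
  graph :=
    { Adj := fun u v => α.graph.Adj u.swap v.swap
      symm := ⟨fun _ _ h => h.symm⟩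
      loopless := ⟨fun _ h => h.ne rfl⟩ }
  eq_of_adj := fun _ _ _ h h' => Sum.swap_leftInverse.injective (α.eq_of_adj _ _ _ h h')

theorem flip_adj (α : PartialBrauer X) (u v : X ⊕ X) :
    α.flip.graph.Adj u v ↔ α.graph.Adj u.swap v.swap := Iff.rfl

@[simp]
theorem flip_flip (α : PartialBrauer X) : α.flip.flip = α := by
  ext u v
  simp [flip_adj]

theorem flip_mul (α β : PartialBrauer X) : (α * β).flip = β.flip * α.flip := by
  have key : ∀ (α β : PartialBrauer X) (u v : X ⊕ X),
      (α * β).graph.Adj u v → (β.flip * α.flip).graph.Adj u.swap v.swap := by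
    intro α β u v h
    refine ⟨fun e => h.1 (Sum.swap_leftInverse.injective e), ?_⟩
    refine reachable_map (f := Sum.map Sum.swap id) (H := prodGraph β.flip α.flip) ?_ h.2
    rintro a b (⟨_, c, d, hcd, rfl, rfl⟩ | ⟨_, c, d, hcd, rfl, rfl⟩)
    · have h1 : α.flip.graph.Adj c.swap d.swap := by simpa [flip_adj] using hcd
      have := (prodGraph_adj_right β.flip h1).reachable
      rcases c with c | c <;> rcases d with d | d <;> exact this
    · have h1 : β.flip.graph.Adj c.swap d.swap := by simpa [flip_adj] using hcd
      have := (prodGraph_adj_left α.flip h1).reachable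
      rcases c with c | c <;> rcases d with d | d <;> exact this
  ext u v
  constructor
  · intro h
    simpa using key α β _ _ h
  · intro h
    have := key _ _ _ _ h
    rwa [flip_flip, flip_flip] at this

theorem flip_one : (1 : PartialBrauer X).flip = 1 := by
  have h := flip_mul (1 : PartialBrauer X).flip 1
  rw [mul_one, flip_flip, mul_one] at h
  exact h.symm

theorem dom_flip (α : PartialBrauer X) : α.flip.dom = α.codom := by
  ext x
  exact exists_congr fun y => α.graph.adj_comm _ _

theorem codom_flip (α : PartialBrauer X) : α.flip.codom = α.dom := by
  rw [← dom_flip, flip_flip]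

theorem defect_flip (α : PartialBrauer X) : α.flip.defect = α.codefect := by
  rw [defect, dom_flip, codefect]

theorem codefect_flip (α : PartialBrauer X) : α.flip.codefect = α.defect := by
  rw [codefect, codom_flip, defect]

theorem flip_mem_rightUnits {α : PartialBrauer X} (h : α ∈ leftUnits (PartialBrauer X)) :
    α.flip ∈ rightUnits (PartialBrauer X) := by
  obtain ⟨γ, hγ⟩ := h
  exact ⟨γ.flip, by rw [← flip_mul, hγ, flip_one]⟩

theorem flip_mem_leftUnits {α : PartialBrauer X} (h : α ∈ rightUnits (PartialBrauer X)) :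
    α.flip ∈ leftUnits (PartialBrauer X) := by
  obtain ⟨γ, hγ⟩ := h
  exact ⟨γ.flip, by rw [← flip_mul, hγ, flip_one]⟩

theorem _root_.IsIdempotentElem.flip {e : PartialBrauer X} (h : IsIdempotentElem e) :
    IsIdempotentElem e.flip := by
  rw [IsIdempotentElem, ← flip_mul, h.eq]

theorem flip_mem_idempotentGenerated {α : PartialBrauer X}
    (h : α ∈ idempotentGenerated (PartialBrauer X)) :
    α.flip ∈ idempotentGenerated (PartialBrauer X) := by
  induction h using Subsemigroup.closure_induction with
  | mem e he => exact Subsemigroup.subset_closure (IsIdempotentElem.flip he)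
  | mul a b _ _ ha hb => rw [flip_mul]; exact mul_mem hb ha

theorem closure_flip_eq_top {S : Set (PartialBrauer X)}
    (h : Subsemigroup.closure
      ((idempotentGenerated (PartialBrauer X) : Set (PartialBrauer X)) ∪ S) = ⊤) :
    Subsemigroup.closure
      ((idempotentGenerated (PartialBrauer X) : Set (PartialBrauer X)) ∪ flip '' S) = ⊤ := by
  refine eq_top_iff.2 fun m _ => ?_
  have key : ∀ a ∈ Subsemigroup.closure
      ((idempotentGenerated (PartialBrauer X) : Set (PartialBrauer X)) ∪ S),
      a.flip ∈ Subsemigroup.closure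
        ((idempotentGenerated (PartialBrauer X) : Set (PartialBrauer X)) ∪ flip '' S) := by
    intro a ha
    induction ha using Subsemigroup.closure_induction with
    | mem a ha =>
      refine Subsemigroup.subset_closure ?_
      rcases ha with ha | ha
      · exact Or.inl (flip_mem_idempotentGenerated ha)
      · exact Or.inr ⟨a, ha, rfl⟩
    | mul a b _ _ ha hb => rw [flip_mul]; exact mul_mem hb ha
  simpa using key m.flip (h ▸ Subsemigroup.mem_top _)

theorem exists_adj_of_mul_adj_lower {α β : PartialBrauer X} {x : X} {v : X ⊕ X}
    (h : (α * β).graph.Adj (Sum.inr x) v) : ∃ w, β.graph.Adj (Sum.inr x) w := by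
  have h' : (β.flip * α.flip).graph.Adj (Sum.inl x) v.swap := by
    rw [← flip_mul, flip_adj]; simpa using h
  obtain ⟨w, hw⟩ := exists_adj_of_mul_adj_upper h'
  exact ⟨_, hw⟩

theorem exists_adj_of_mul_adj_of_adj' {α β : PartialBrauer X} {y z : X} {v : X ⊕ X}
    (h : (α * β).graph.Adj (Sum.inr z) v) (hyz : β.graph.Adj (Sum.inl y) (Sum.inr z)) :
    ∃ w, α.graph.Adj (Sum.inr y) w := by
  have h' : (β.flip * α.flip).graph.Adj (Sum.inl z) v.swap := by
    rw [← flip_mul, flip_adj]; simpa using h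
  obtain ⟨w, hw⟩ := exists_adj_of_mul_adj_of_adj h' (y := y) hyz.symm
  exact ⟨_, hw⟩

/-- If hooks of `α` and `β` never meet each other or transversals of the other factor in the middle
row, then the product can be computed edge by edge. -/
theorem mul_adj_of_compatible {α β : PartialBrauer X}
    (H : ∀ y u v, α.graph.Adj (Sum.inr y) u → β.graph.Adj (Sum.inl y) v →
      ∃ x z, u = Sum.inl x ∧ v = Sum.inr z) :
    (∀ x y, (α * β).graph.Adj (Sum.inl x) (Sum.inl y) ↔ α.graph.Adj (Sum.inl x) (Sum.inl y)) ∧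
    (∀ x z, (α * β).graph.Adj (Sum.inl x) (Sum.inr z) ↔
      ∃ y, α.graph.Adj (Sum.inl x) (Sum.inr y) ∧ β.graph.Adj (Sum.inl y) (Sum.inr z)) ∧
    (∀ x y, (α * β).graph.Adj (Sum.inr x) (Sum.inr y) ↔ β.graph.Adj (Sum.inr x) (Sum.inr y)) := by
  have top : ∀ x v, (α * β).graph.Adj (Sum.inl x) v →
      (∃ y, v = Sum.inl y ∧ α.graph.Adj (Sum.inl x) (Sum.inl y)) ∨
      ∃ y z, v = Sum.inr z ∧
        α.graph.Adj (Sum.inl x) (Sum.inr y) ∧ β.graph.Adj (Sum.inl y) (Sum.inr z) := by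
    intro x v h
    obtain ⟨y | y, hw⟩ := exists_adj_of_mul_adj_upper h
    · exact Or.inl ⟨y, (α * β).eq_of_adj _ _ _ h (mul_adj_upper β hw), hw⟩
    · obtain ⟨w, hw'⟩ := exists_adj_of_mul_adj_of_adj h hw
      obtain ⟨_, z, _, rfl⟩ := H y _ _ hw.symm hw'
      exact Or.inr ⟨y, z, (α * β).eq_of_adj _ _ _ h (mul_adj_transversal hw hw'), hw, hw'⟩
  refine ⟨fun x y => ⟨fun h => ?_, mul_adj_upper β⟩,
    fun x z => ⟨fun h => ?_, fun ⟨y, h, h'⟩ => mul_adj_transversal h h'⟩,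
    fun x y => ⟨fun h => ?_, mul_adj_lower α⟩⟩
  · obtain ⟨y, e, h⟩ | ⟨_, _, e, _⟩ := top _ _ h
    · rwa [e]
    · simp at e
  · obtain ⟨y, e, _⟩ | ⟨y, z, e, h⟩ := top _ _ h
    · simp at e
    · obtain rfl := Sum.inr_injective e
      exact ⟨y, h⟩
  · obtain ⟨w | w, hw⟩ := exists_adj_of_mul_adj_lower h
    · obtain ⟨v, hv⟩ := exists_adj_of_mul_adj_of_adj' h hw.symm
      obtain ⟨t, _, rfl, _⟩ := H w _ _ hv hw.symm
      have := (α * β).eq_of_adj _ _ _ h (mul_adj_transversal hv.symm hw.symm).symm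
      simp at this
    · rwa [(α * β).eq_of_adj _ _ _ h (mul_adj_lower α hw)]

/-! ### Necessary conditions on generators -/

theorem dom_eq_univ_of_mem_rightUnits {α : PartialBrauer X}
    (h : α ∈ rightUnits (PartialBrauer X)) : α.dom = Set.univ := by
  obtain ⟨γ, hγ⟩ := h
  refine Set.eq_univ_of_forall fun x => ?_
  have h1 : (α * γ).graph.Adj (Sum.inl x) (Sum.inr x) := by
    rw [hγ, one_adj]; exact ⟨x, Or.inl ⟨rfl, rfl⟩⟩
  obtain ⟨y | y, hw⟩ := exists_adj_of_mul_adj_upper h1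
  · have := (α * γ).eq_of_adj _ _ _ h1 (mul_adj_upper γ hw)
    simp at this
  · exact ⟨y, hw⟩

theorem defect_eq_zero_of_mem_rightUnits {α : PartialBrauer X}
    (h : α ∈ rightUnits (PartialBrauer X)) : α.defect = 0 := by
  rw [defect, dom_eq_univ_of_mem_rightUnits h]
  simp

theorem codefect_eq_zero_of_mem_leftUnits {α : PartialBrauer X}
    (h : α ∈ leftUnits (PartialBrauer X)) : α.codefect = 0 := by
  rw [← defect_flip, defect_eq_zero_of_mem_rightUnits (flip_mem_rightUnits h)]

theorem mem_rightUnits_of_mul {M : Type u} [Monoid M] {a b : M} (h : a * b ∈ rightUnits M) :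
    a ∈ rightUnits M := by
  obtain ⟨c, hc⟩ := h
  exact ⟨b * c, by rw [← mul_assoc, hc]⟩

theorem eq_one_of_isIdempotentElem {M : Type u} [Monoid M] {e : M} (he : IsIdempotentElem e)
    (h : e ∈ rightUnits M) : e = 1 := by
  obtain ⟨c, hc⟩ := h
  calc e = e * e * c := by rw [mul_assoc, hc, mul_one]
    _ = 1 := by rw [he.eq, hc]

/-- A transversal `{x, y'}` of an idempotent with `x ≠ y` has `x` outside the codomain and `y`
outside the domain, so transversals match `dom e \ codom e` with `codom e \ dom e`. -/
theorem defect_eq_codefect_of_isIdempotentElem {e : PartialBrauer X} (he : IsIdempotentElem e) :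
    e.defect = e.codefect := by
  have tr : ∀ {x y z}, e.graph.Adj (Sum.inl x) (Sum.inr y) →
      e.graph.Adj (Sum.inl y) (Sum.inr z) → e.graph.Adj (Sum.inl x) (Sum.inr z) := by
    intro x y z h h'
    have := mul_adj_transversal h h'
    rwa [he.eq] at this
  have h1 : ∀ {x y}, e.graph.Adj (Sum.inl x) (Sum.inr y) → y ∈ e.dom → x = y := by
    rintro x y h ⟨z, hz⟩
    obtain rfl := Sum.inr_injective (e.eq_of_adj _ _ _ h (tr h hz))
    exact Sum.inl_injective (e.eq_of_adj _ _ _ h.symm hz.symm)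
  have h2 : ∀ {x y}, e.graph.Adj (Sum.inl x) (Sum.inr y) → x ∈ e.codom → x = y := by
    rintro x y h ⟨w, hw⟩
    obtain rfl := Sum.inl_injective (e.eq_of_adj _ _ _ h.symm (tr hw h).symm)
    exact Sum.inr_injective (e.eq_of_adj _ _ _ hw h)
  have key : #(e.codom \ e.dom : Set X) = #(e.dom \ e.codom : Set X) := by
    choose f hf using fun y : (e.codom \ e.dom : Set X) => y.2.1
    refine Cardinal.mk_congr (Equiv.ofBijective
      (fun y => (⟨f y, ⟨y, hf y⟩, fun hc => y.2.2 ?_⟩ : (e.dom \ e.codom : Set X))) ⟨?_, ?_⟩)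
    · rw [← h2 (hf y) hc]; exact ⟨y, hf y⟩
    · intro y z h
      have h : f y = f z := congrArg Subtype.val h
      have h3 := hf z
      rw [← h] at h3
      exact Subtype.ext (Sum.inr_injective (e.eq_of_adj _ _ _ (hf y) h3))
    · rintro ⟨x, ⟨y, hy⟩, hx⟩
      refine ⟨⟨y, ⟨x, hy⟩, fun hd => hx ?_⟩, Subtype.ext ?_⟩
      · rw [h1 hy hd]; exact ⟨x, hy⟩
      · exact Sum.inl_injective (e.eq_of_adj _ _ _ (hf _).symm hy.symm)
  have split : ∀ A B : Set X, #(Aᶜ : Set X) = #(B \ A : Set X) + #((A ∪ B)ᶜ : Set X) := by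
    intro A B
    rw [← Cardinal.mk_union_of_disjoint]
    · congr 2
      ext x
      simp only [Set.mem_compl_iff, Set.mem_union, Set.mem_sdiff]
      tauto
    · refine Set.disjoint_left.2 fun x hx hx' => hx' (Or.inr hx.1)
  rw [defect, codefect, split e.dom e.codom, split e.codom e.dom, key, Set.union_comm]

/-- Each vertex of `codom r \ dom x` lies on an upper hook of `x` whose other end avoids
`codom r`. -/
theorem defect_le_of_mul_mem_rightUnits {r x : PartialBrauer X}
    (h : r * x ∈ rightUnits (PartialBrauer X)) : x.defect ≤ r.codefect + r.codefect := by
  have hd := dom_eq_univ_of_mem_rightUnits h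
  have key : ∀ a : (r.codom \ x.dom : Set X), ∃ c : (r.codomᶜ : Set X),
      x.graph.Adj (Sum.inl a) (Sum.inl c) := by
    rintro ⟨a, ⟨y, hy⟩, ha⟩
    obtain ⟨z, hz⟩ : y ∈ (r * x).dom := hd ▸ Set.mem_univ y
    obtain ⟨c | c, hc⟩ := exists_adj_of_mul_adj_of_adj hz hy
    · refine ⟨⟨c, ?_⟩, hc⟩
      rintro ⟨y', hy'⟩
      have := (r * x).eq_of_adj _ _ _ hz (mul_adj_upper_of_hook hy hc hy')
      simp at this
    · exact absurd ⟨c, hc⟩ ha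
  choose f hf using key
  have hinj : Function.Injective f := by
    intro a b hab
    have h1 := hf b
    rw [← hab] at h1
    exact Subtype.ext (Sum.inl_injective (x.eq_of_adj _ _ _ (hf a).symm h1.symm))
  calc x.defect ≤ #((r.codomᶜ ∪ (r.codom \ x.dom) : Set X)) := by
        refine Cardinal.mk_le_mk_of_subset fun a ha => ?_
        by_cases h : a ∈ r.codom
        · exact Or.inr ⟨h, ha⟩
        · exact Or.inl h
    _ ≤ #(r.codomᶜ : Set X) + #(r.codom \ x.dom : Set X) := Cardinal.mk_union_le _ _
    _ ≤ _ := by gcongr; exacts [le_rfl, Cardinal.mk_le_of_injective hinj]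

theorem codefect_mul_le (r x : PartialBrauer X) :
    (r * x).codefect ≤ x.codefect + r.codefect := by
  have key : ∀ z : (x.codom \ (r * x).codom : Set X), ∃ w : (r.codomᶜ : Set X),
      x.graph.Adj (Sum.inl w) (Sum.inr z) := by
    rintro ⟨z, ⟨w, hw⟩, hz⟩
    exact ⟨⟨w, fun ⟨y, hy⟩ => hz ⟨y, mul_adj_transversal hy hw⟩⟩, hw⟩
  choose f hf using key
  have hinj : Function.Injective f := by
    intro a b hab
    have h1 := hf b
    rw [← hab] at h1
    exact Subtype.ext (Sum.inr_injective (x.eq_of_adj _ _ _ (hf a) h1))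
  calc (r * x).codefect ≤ #((x.codomᶜ ∪ (x.codom \ (r * x).codom) : Set X)) := by
        refine Cardinal.mk_le_mk_of_subset fun a ha => ?_
        by_cases h : a ∈ x.codom
        · exact Or.inr ⟨h, ha⟩
        · exact Or.inl h
    _ ≤ #(x.codomᶜ : Set X) + #(x.codom \ (r * x).codom : Set X) := Cardinal.mk_union_le _ _
    _ ≤ _ := by gcongr; exacts [le_rfl, Cardinal.mk_le_of_injective hinj]

/-! ### Transversals and hooks -/

/-- The Brauer graph with edges `{p i, (q i)'}`. -/
def transversals {I : Type u} (p q : I ↪ X) : PartialBrauer X where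
  graph :=
    { Adj := fun u v => ∃ i, (u = Sum.inl (p i) ∧ v = Sum.inr (q i)) ∨
        (u = Sum.inr (q i) ∧ v = Sum.inl (p i))
      symm := ⟨fun _ _ ⟨i, h⟩ => ⟨i, h.symm.imp And.symm And.symm⟩⟩
      loopless := ⟨by rintro _ ⟨x, ⟨rfl, h⟩ | ⟨rfl, h⟩⟩ <;> simp at h⟩ }
  eq_of_adj := by
    rintro u v w ⟨x, ⟨rfl, rfl⟩ | ⟨rfl, rfl⟩⟩ ⟨y, ⟨h, rfl⟩ | ⟨h, rfl⟩⟩ <;> simp_all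

/-- The Brauer graph with edges `{x, x'}` for `x ∈ A`, and with the edges of `L` as lower hooks.
The graph `L` has to be a matching that avoids `A`. -/
def lowerHooks (A : Set X) (L : SimpleGraph X) (hL : ∀ x y z, L.Adj x y → L.Adj x z → y = z)
    (hA : ∀ x y, L.Adj x y → x ∉ A) : PartialBrauer X where
  graph :=
    { Adj := fun u v => (∃ x ∈ A, (u = Sum.inl x ∧ v = Sum.inr x) ∨
        (u = Sum.inr x ∧ v = Sum.inl x)) ∨ ∃ x y, L.Adj x y ∧ u = Sum.inr x ∧ v = Sum.inr y
      symm := ⟨by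
        rintro _ _ (⟨x, hx, h⟩ | ⟨x, y, h, h1, h2⟩)
        · exact Or.inl ⟨x, hx, h.symm.imp And.symm And.symm⟩
        · exact Or.inr ⟨y, x, h.symm, h2, h1⟩⟩
      loopless := ⟨by
        rintro _ (⟨x, _, ⟨rfl, h⟩ | ⟨rfl, h⟩⟩ | ⟨x, y, h, rfl, h2⟩)
        · simp at h
        · simp at h
        · exact h.ne (Sum.inr_injective h2)⟩ }
  eq_of_adj := by
    rintro u v w (⟨x, hx, ⟨rfl, rfl⟩ | ⟨rfl, rfl⟩⟩ | ⟨x, x', h, rfl, rfl⟩)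
      (⟨y, hy, ⟨h', rfl⟩ | ⟨h', rfl⟩⟩ | ⟨y, y', h'', h', rfl⟩)
    · simpa using h'
    · simp at h'
    · simp at h'
    · simp at h'
    · simpa using h'
    · obtain rfl := Sum.inr_injective h'
      exact absurd hx (hA _ _ h'')
    · simp at h'
    · obtain rfl := Sum.inr_injective h'
      exact absurd hy (hA _ _ h)
    · obtain rfl := Sum.inr_injective h'
      rw [hL _ _ _ h h'']

section

variable {I : Type u} {p q r : I ↪ X}

@[simp]
theorem transversals_adj_upper (p q : I ↪ X) (x y : X) :
    ¬ (transversals p q).graph.Adj (Sum.inl x) (Sum.inl y) := by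
  rintro ⟨i, ⟨_, h⟩ | ⟨h, _⟩⟩ <;> simp at h

@[simp]
theorem transversals_adj_lower (p q : I ↪ X) (x y : X) :
    ¬ (transversals p q).graph.Adj (Sum.inr x) (Sum.inr y) := by
  rintro ⟨i, ⟨h, _⟩ | ⟨_, h⟩⟩ <;> simp at h

@[simp]
theorem transversals_adj (p q : I ↪ X) (x y : X) :
    (transversals p q).graph.Adj (Sum.inl x) (Sum.inr y) ↔ ∃ i, p i = x ∧ q i = y := by
  constructor
  · rintro ⟨i, ⟨h, h'⟩ | ⟨h, _⟩⟩
    · exact ⟨i, (Sum.inl_injective h).symm, (Sum.inr_injective h').symm⟩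
    · simp at h
  · rintro ⟨i, rfl, rfl⟩
    exact ⟨i, Or.inl ⟨rfl, rfl⟩⟩

theorem flip_transversals (p q : I ↪ X) : (transversals p q).flip = transversals q p := by
  refine ext_hooks ?_ ?_ ?_
  · simp [flip_adj]
  · intro x y
    rw [flip_adj, SimpleGraph.adj_comm]
    simp [and_comm]
  · simp [flip_adj]

theorem transversals_refl :
    transversals (Function.Embedding.refl X) (Function.Embedding.refl X) = 1 := by
  refine ext_hooks ?_ ?_ ?_ <;> simp [one_adj, eq_comm]

theorem dom_transversals (p q : I ↪ X) : (transversals p q).dom = Set.range p := by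
  ext x
  simp [dom]

theorem codom_transversals (p q : I ↪ X) : (transversals p q).codom = Set.range q := by
  rw [← dom_flip, flip_transversals, dom_transversals]

theorem exists_eq_inl_of_transversals_adj {y : X} {u : X ⊕ X}
    (h : (transversals p q).graph.Adj (Sum.inr y) u) : ∃ x, u = Sum.inl x := by
  rcases u with x | x
  · exact ⟨x, rfl⟩
  · exact absurd h (transversals_adj_lower _ _ _ _)

theorem exists_eq_inr_of_transversals_adj {y : X} {u : X ⊕ X}
    (h : (transversals p q).graph.Adj (Sum.inl y) u) : ∃ x, u = Sum.inr x := by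
  rcases u with x | x
  · exact absurd h (transversals_adj_upper _ _ _ _)
  · exact ⟨x, rfl⟩

theorem transversals_mul {J : Type u} (p q : I ↪ X) (s : J ↪ I) (r : J ↪ X) :
    transversals p q * transversals (s.trans q) r = transversals (s.trans p) r := by
  obtain ⟨h1, h2, h3⟩ := mul_adj_of_compatible (α := transversals p q)
    (β := transversals (s.trans q) r) (fun y u v h h' => by
      obtain ⟨x, rfl⟩ := exists_eq_inl_of_transversals_adj h
      obtain ⟨z, rfl⟩ := exists_eq_inr_of_transversals_adj h'
      exact ⟨x, z, rfl, rfl⟩)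
  refine ext_hooks (fun x y => ?_) (fun x z => ?_) (fun x y => ?_)
  · simp [h1]
  · rw [h2]
    simp only [transversals_adj, Function.Embedding.trans_apply]
    constructor
    · rintro ⟨y, ⟨i, rfl, rfl⟩, j, hj, rfl⟩
      exact ⟨j, by rw [q.injective hj], rfl⟩
    · rintro ⟨j, rfl, rfl⟩
      exact ⟨q (s j), ⟨s j, rfl, rfl⟩, j, rfl, rfl⟩
  · simp [h3]

theorem transversals_mul_transversals (p q r : I ↪ X) :
    transversals p q * transversals q r = transversals p r :=
  transversals_mul p q (Function.Embedding.refl I) r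

theorem transversals_mul' {J : Type u} (p q : I ↪ X) (s : J ↪ I) (r : J ↪ X) :
    transversals r (s.trans q) * transversals q p = transversals r (s.trans p) := by
  rw [← flip_transversals _ r, ← flip_transversals p q, ← flip_mul, transversals_mul,
    flip_transversals]

variable {A : Set X} {L : SimpleGraph X} {hL : ∀ x y z, L.Adj x y → L.Adj x z → y = z}
  {hA : ∀ x y, L.Adj x y → x ∉ A}

@[simp]
theorem lowerHooks_adj_upper (x y : X) :
    ¬ (lowerHooks A L hL hA).graph.Adj (Sum.inl x) (Sum.inl y) := by
  simp [lowerHooks]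

@[simp]
theorem lowerHooks_adj_lower (x y : X) :
    (lowerHooks A L hL hA).graph.Adj (Sum.inr x) (Sum.inr y) ↔ L.Adj x y := by
  simp [lowerHooks]

@[simp]
theorem lowerHooks_adj (x y : X) :
    (lowerHooks A L hL hA).graph.Adj (Sum.inl x) (Sum.inr y) ↔ x = y ∧ x ∈ A := by
  simp [lowerHooks]
  aesop

theorem isIdempotentElem_lowerHooks : IsIdempotentElem (lowerHooks A L hL hA) := by
  obtain ⟨h1, h2, h3⟩ := mul_adj_of_compatible (α := lowerHooks A L hL hA)
    (β := lowerHooks A L hL hA) (fun y u v h h' => by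
      rcases v with z | z
      · simp at h'
      rcases u with x | x
      · exact ⟨x, z, rfl, rfl⟩
      · simp at h h'
        exact absurd h'.2 (hA _ _ h))
  refine ext_hooks (fun x y => ?_) (fun x z => ?_) (fun x y => ?_)
  · simp [h1]
  · rw [h2]
    simp
  · simp [h3]

theorem lowerHooks_mem : lowerHooks A L hL hA ∈ idempotentGenerated (PartialBrauer X) :=
  Subsemigroup.subset_closure isIdempotentElem_lowerHooks

theorem transversals_self_mem (p : I ↪ X) :
    transversals p p ∈ idempotentGenerated (PartialBrauer X) :=
  Subsemigroup.subset_closure (transversals_mul_transversals p p p)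

/-- Three pairwise disjoint copies of `I` suffice to move one of them to another by a product of
two idempotents: lower hooks `{(q i)', (r i)'}` of the first meet upper hooks `{p i, r i}` of the
second, giving the path `p i — (p i)'' — (r i)'' — (q i)'' — (q i)'`. -/
theorem transversals_mem_of_disjoint (hpq : ∀ i j, p i ≠ q j) (hpr : ∀ i j, p i ≠ r j)
    (hqr : ∀ i j, q i ≠ r j) :
    transversals p q ∈ idempotentGenerated (PartialBrauer X) := by
  have hooks : ∀ p q r : I ↪ X, (∀ i j, p i ≠ q j) → (∀ i j, p i ≠ r j) → (∀ i j, q i ≠ r j) →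
      ∃ a ∈ idempotentGenerated (PartialBrauer X),
        (∀ i, a.graph.Adj (Sum.inl (p i)) (Sum.inr (p i))) ∧
        (∀ i, a.graph.Adj (Sum.inr (q i)) (Sum.inr (r i))) ∧
        ∀ x v, a.graph.Adj (Sum.inl x) v → ∃ i, x = p i := by
    intro p q r hpq hpr hqr
    let L : SimpleGraph X :=
      { Adj := fun x y => ∃ i, (x = q i ∧ y = r i) ∨ (x = r i ∧ y = q i)
        symm := ⟨fun _ _ ⟨i, h⟩ => ⟨i, h.symm.imp And.symm And.symm⟩⟩
        loopless := ⟨by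
          rintro _ ⟨i, ⟨rfl, h⟩ | ⟨rfl, h⟩⟩
          exacts [hqr _ _ h, hqr _ _ h.symm]⟩ }
    refine ⟨lowerHooks (Set.range p) L ?_ ?_, lowerHooks_mem, ?_, ?_, ?_⟩
    · rintro x y z ⟨i, ⟨rfl, rfl⟩ | ⟨rfl, rfl⟩⟩ ⟨j, ⟨h, rfl⟩ | ⟨h, rfl⟩⟩
      · rw [q.injective h]
      · exact absurd h (hqr _ _)
      · exact absurd h.symm (hqr _ _)
      · rw [r.injective h]
    · rintro x y ⟨i, ⟨rfl, rfl⟩ | ⟨rfl, rfl⟩⟩ ⟨j, hj⟩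
      exacts [hpq _ _ hj, hpr _ _ hj]
    · simp
    · intro i
      rw [lowerHooks_adj_lower]
      exact ⟨i, Or.inl ⟨rfl, rfl⟩⟩
    · rintro x (v | v) h
      · simp at h
      · rw [lowerHooks_adj] at h
        obtain ⟨i, hi⟩ := h.2
        exact ⟨i, hi.symm⟩
  obtain ⟨a, ha, ha1, ha2, ha3⟩ := hooks p q r hpq hpr hqr
  obtain ⟨b, hb, hb1, hb2, hb3⟩ := hooks q p r (fun i j => (hpq j i).symm) hqr hpr
  have hab : a * b.flip = transversals p q := by
    refine eq_of_le_of_forall_exists_adj ?_ ?_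
    · have hadj : ∀ i, (a * b.flip).graph.Adj (Sum.inl (p i)) (Sum.inr (q i)) := fun i =>
        ⟨by simp, (((prodGraph_adj_left b.flip (ha1 i)).reachable.trans
          (prodGraph_adj_right a (β := b.flip) (u := Sum.inl (p i)) (v := Sum.inl (r i))
            (hb2 i)).reachable).trans
          (prodGraph_adj_left b.flip (ha2 i)).symm.reachable).trans
          (prodGraph_adj_right a (β := b.flip) (u := Sum.inl (q i)) (v := Sum.inr (q i))
            (hb1 i).symm).reachable⟩
      rintro _ _ ⟨i, ⟨rfl, rfl⟩ | ⟨rfl, rfl⟩⟩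
      exacts [hadj i, (hadj i).symm]
    · rintro (x | x) v h
      · obtain ⟨w, hw⟩ := exists_adj_of_mul_adj_upper h
        obtain ⟨i, rfl⟩ := ha3 _ _ hw
        exact ⟨_, i, Or.inl ⟨rfl, rfl⟩⟩
      · obtain ⟨w, hw⟩ := exists_adj_of_mul_adj_lower h
        obtain ⟨i, rfl⟩ := hb3 _ _ hw
        exact ⟨_, i, Or.inr ⟨rfl, rfl⟩⟩
  rw [← hab]
  exact mul_mem ha (flip_mem_idempotentGenerated hb)

/-- A set of full cardinality contains two disjoint copies of any set embedded in `X`. -/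
theorem exists_two_embeddings [Infinite X] (p : I ↪ X) {D : Set X} (hD : #D = #X) :
    ∃ s t : I ↪ X, (∀ i, s i ∈ D) ∧ (∀ i, t i ∈ D) ∧ ∀ i j, s i ≠ t j := by
  have hle : #(I ⊕ I) ≤ #D := by
    have hI : #I ≤ #X := ⟨p⟩
    rw [hD, Cardinal.mk_sum, Cardinal.lift_id]
    exact Cardinal.add_le_of_le (Cardinal.aleph0_le_mk X) hI hI
  obtain ⟨g⟩ := hle
  refine ⟨(Function.Embedding.inl.trans g).trans (Function.Embedding.subtype _),
    (Function.Embedding.inr.trans g).trans (Function.Embedding.subtype _),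
    fun i => (g _).2, fun i => (g _).2, fun i j h => ?_⟩
  have := g.injective (Subtype.ext h : g (Sum.inl i) = g (Sum.inr j))
  simp at this

theorem transversals_mem_of_union [Infinite X]
    (h : #((Set.range p ∪ Set.range q)ᶜ : Set X) = #X) :
    transversals p q ∈ idempotentGenerated (PartialBrauer X) := by
  obtain ⟨s, t, hs, ht, hst⟩ := exists_two_embeddings p h
  rw [← transversals_mul_transversals p s q]
  refine mul_mem (transversals_mem_of_disjoint (r := t) ?_ ?_ hst)
    (transversals_mem_of_disjoint (r := t) ?_ hst ?_)
  · exact fun i j e => hs j (Or.inl ⟨i, e⟩)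
  · exact fun i j e => ht j (Or.inl ⟨i, e⟩)
  · exact fun i j e => hs i (Or.inr ⟨j, e.symm⟩)
  · exact fun i j e => ht j (Or.inr ⟨i, e⟩)

theorem transversals_mem [Infinite X] (hp : #((Set.range p)ᶜ : Set X) = #X)
    (hq : #((Set.range q)ᶜ : Set X) = #X) :
    transversals p q ∈ idempotentGenerated (PartialBrauer X) := by
  by_cases h : #((Set.range p ∪ Set.range q)ᶜ : Set X) = #X
  · exact transversals_mem_of_union h
  -- Now `range q \ range p` is large, and `range p` can first be moved into it.
  have hqp : #(Set.range q \ Set.range p : Set X) = #X := by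
    refine le_antisymm (Cardinal.mk_set_le _) (not_lt.1 fun hlt => ?_)
    have h1 := Cardinal.add_lt_of_lt (Cardinal.aleph0_le_mk X) hlt
      (lt_of_le_of_ne (Cardinal.mk_set_le _) h)
    refine absurd (lt_of_le_of_lt (Cardinal.mk_union_le _ _) h1) (not_lt.2 ?_)
    rw [← hp]
    refine Cardinal.mk_le_mk_of_subset fun x hx => ?_
    by_cases hxq : x ∈ Set.range q
    · exact Or.inl ⟨hxq, hx⟩
    · exact Or.inr fun hx' => hx'.elim hx hxq
  obtain ⟨s, t, hs, ht, hst⟩ := exists_two_embeddings p hqp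
  rw [← transversals_mul_transversals p s q]
  refine mul_mem (transversals_mem_of_disjoint (r := t) ?_ ?_ hst) (transversals_mem_of_union ?_)
  · exact fun i j e => (hs j).2 ⟨i, e⟩
  · exact fun i j e => (ht j).2 ⟨i, e⟩
  · rw [Set.union_eq_self_of_subset_left, hq]
    rintro _ ⟨i, rfl⟩
    exact (hs i).1

/-- Every Brauer graph splits into its upper hooks, its transversals, and its lower hooks, and the
two outer factors are idempotents. -/
theorem exists_eq_mul_transversals_mul (γ : PartialBrauer X) :
    ∃ (I : Type u) (s h : I ↪ X), ∃ e ∈ idempotentGenerated (PartialBrauer X),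
      ∃ f ∈ idempotentGenerated (PartialBrauer X), γ = e * transversals s h * f := by
  have hooks : ∀ γ : PartialBrauer X, ∃ f ∈ idempotentGenerated (PartialBrauer X),
      (∀ x y, ¬ f.graph.Adj (Sum.inl x) (Sum.inl y)) ∧
      (∀ x y, f.graph.Adj (Sum.inl x) (Sum.inr y) ↔ x = y ∧ x ∈ γ.codom) ∧
      ∀ x y, f.graph.Adj (Sum.inr x) (Sum.inr y) ↔ γ.graph.Adj (Sum.inr x) (Sum.inr y) := by
    intro γ
    refine ⟨lowerHooks γ.codom (γ.graph.comap Sum.inr) ?_ ?_, lowerHooks_mem,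
      lowerHooks_adj_upper, lowerHooks_adj, lowerHooks_adj_lower⟩
    · exact fun x y z h h' => Sum.inr_injective (γ.eq_of_adj _ _ _ h h')
    · rintro x y h ⟨z, hz⟩
      have := γ.eq_of_adj _ _ _ h hz.symm
      simp at this
  obtain ⟨f, hf, hf1, hf2, hf3⟩ := hooks γ
  obtain ⟨e, he, he1, he2, he3⟩ := hooks γ.flip
  rw [codom_flip] at he2
  choose h hh using fun x : γ.dom => x.2
  have hinj : Function.Injective h := by
    intro x y hxy
    have h1 := hh y
    rw [← hxy] at h1
    exact Subtype.ext (Sum.inl_injective (γ.eq_of_adj _ _ _ (hh x).symm h1.symm))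
  refine ⟨γ.dom, Function.Embedding.subtype _, ⟨h, hinj⟩, e.flip,
    flip_mem_idempotentGenerated he, f, hf, ?_⟩
  set τ := transversals (Function.Embedding.subtype (· ∈ γ.dom)) ⟨h, hinj⟩ with hτ
  have hτ2 : ∀ x y, τ.graph.Adj (Sum.inl x) (Sum.inr y) ↔
      γ.graph.Adj (Sum.inl x) (Sum.inr y) := by
    intro x y
    rw [hτ, transversals_adj]
    constructor
    · rintro ⟨i, rfl, rfl⟩
      exact hh i
    · intro hxy
      exact ⟨⟨x, y, hxy⟩, rfl, Sum.inr_injective (γ.eq_of_adj _ _ _ (hh ⟨x, y, hxy⟩) hxy)⟩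
  have he2' : ∀ x y, e.flip.graph.Adj (Sum.inl x) (Sum.inr y) ↔ x = y ∧ x ∈ γ.dom := by
    intro x y
    rw [SimpleGraph.adj_comm]
    refine (he2 y x).trans ⟨?_, ?_⟩ <;> rintro ⟨rfl, h⟩ <;> exact ⟨rfl, h⟩
  obtain ⟨a1, a2, a3⟩ := mul_adj_of_compatible (α := e.flip) (β := τ) (fun y u v h h' => by
    obtain ⟨z, rfl⟩ := exists_eq_inr_of_transversals_adj h'
    rcases u with x | x
    · exact ⟨x, z, rfl, rfl⟩
    · exact absurd h (he1 _ _))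
  obtain ⟨b1, b2, b3⟩ := mul_adj_of_compatible (α := e.flip * τ) (β := f) (fun y u v h h' => by
    rcases v with z | z
    · exact absurd h' (hf1 _ _)
    rcases u with x | x
    · exact ⟨x, z, rfl, rfl⟩
    · rw [a3] at h
      exact absurd h (transversals_adj_lower _ _ _ _))
  refine ext_hooks (fun x y => ?_) (fun x y => ?_) (fun x y => ?_)
  · rw [b1, a1]
    exact (he3 x y).symm
  · simp only [b2, a2, hτ2, he2', hf2]
    constructor
    · exact fun h => ⟨y, ⟨x, ⟨rfl, y, h⟩, h⟩, rfl, x, h⟩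
    · rintro ⟨_, ⟨_, ⟨rfl, _⟩, h⟩, rfl, _⟩
      exact h
  · rw [b3, hf3]

/-- Multiplying a right unit by a partial identity removes everything except its transversals. -/
theorem exists_mul_eq_transversals {α : PartialBrauer X}
    (h : α ∈ rightUnits (PartialBrauer X)) :
    ∃ f : X ↪ X, Set.range f = α.codom ∧
      α * transversals f f = transversals (Function.Embedding.refl X) f := by
  have hd := dom_eq_univ_of_mem_rightUnits h
  choose f hf using fun x : X => (hd ▸ Set.mem_univ x : x ∈ α.dom)
  have hinj : Function.Injective f := by
    intro x y hxy
    have h1 := hf y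
    rw [← hxy] at h1
    exact Sum.inl_injective (α.eq_of_adj _ _ _ (hf x).symm h1.symm)
  refine ⟨⟨f, hinj⟩, ?_, ?_⟩
  · ext y
    constructor
    · rintro ⟨x, rfl⟩
      exact ⟨x, hf x⟩
    · rintro ⟨x, hx⟩
      exact ⟨x, Sum.inr_injective (α.eq_of_adj _ _ _ (hf x) hx)⟩
  · obtain ⟨h1, h2, h3⟩ := mul_adj_of_compatible (α := α)
      (β := transversals ⟨f, hinj⟩ ⟨f, hinj⟩) (fun y u v h h' => by
        obtain ⟨z, rfl⟩ := exists_eq_inr_of_transversals_adj h'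
        rw [transversals_adj] at h'
        obtain ⟨i, rfl, _⟩ := h'
        exact ⟨i, z, α.eq_of_adj _ _ _ h (hf i).symm, rfl⟩)
    refine ext_hooks (fun x y => ?_) (fun x y => ?_) (fun x y => ?_)
    · rw [h1]
      refine iff_of_false (fun hxy => ?_) (transversals_adj_upper _ _ _ _)
      have := α.eq_of_adj _ _ _ hxy (hf x)
      simp at this
    · rw [h2]
      simp only [transversals_adj, Function.Embedding.refl_apply, Function.Embedding.coeFn_mk]
      constructor
      · rintro ⟨z, hz, i, rfl, rfl⟩
        exact ⟨x, rfl, Sum.inr_injective (α.eq_of_adj _ _ _ (hf x) hz)⟩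
      · rintro ⟨_, rfl, rfl⟩
        exact ⟨_, hf _, _, rfl, rfl⟩
    · rw [h3]
      simp

end

/-! ### Generating pairs -/

section

variable [Infinite X]

theorem closure_eq_top {α β : PartialBrauer X} (hα : α ∈ rightUnits (PartialBrauer X))
    (hβ : β ∈ leftUnits (PartialBrauer X)) (hα' : α.codefect = #X) (hβ' : β.defect = #X) :
    Subsemigroup.closure
      ((idempotentGenerated (PartialBrauer X) : Set (PartialBrauer X)) ∪ {α, β}) = ⊤ := by
  set S := Subsemigroup.closure
    ((idempotentGenerated (PartialBrauer X) : Set (PartialBrauer X)) ∪ {α, β}) with hS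
  have hE : ∀ {m}, m ∈ idempotentGenerated (PartialBrauer X) → m ∈ S := fun h =>
    Subsemigroup.subset_closure (Or.inl h)
  have hαS : α ∈ S := Subsemigroup.subset_closure (Or.inr (Or.inl rfl))
  have hβS : β ∈ S := Subsemigroup.subset_closure (Or.inr (Or.inr rfl))
  obtain ⟨f, hf, hf'⟩ := exists_mul_eq_transversals hα
  obtain ⟨g, hg, hg'⟩ := exists_mul_eq_transversals (flip_mem_rightUnits hβ)
  rw [codom_flip] at hg
  replace hg' : transversals g g * β = transversals g (Function.Embedding.refl X) := by
    have := congrArg flip hg'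
    rwa [flip_mul, flip_flip, flip_transversals, flip_transversals] at this
  have hfS : transversals (Function.Embedding.refl X) f ∈ S :=
    hf' ▸ mul_mem hαS (hE (transversals_self_mem f))
  have hgS : transversals g (Function.Embedding.refl X) ∈ S :=
    hg' ▸ mul_mem (hE (transversals_self_mem g)) hβS
  have large : ∀ {I : Type u} (s : I ↪ X) (f : X ↪ X), #((Set.range f)ᶜ : Set X) = #X →
      #((Set.range (s.trans f))ᶜ : Set X) = #X := by
    intro I s f h
    refine le_antisymm (Cardinal.mk_set_le _) ?_
    rw [← h]
    refine Cardinal.mk_le_mk_of_subset (Set.compl_subset_compl.2 ?_)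
    rintro _ ⟨i, rfl⟩
    exact ⟨s i, rfl⟩
  refine eq_top_iff.2 fun γ _ => ?_
  obtain ⟨I, s, h, e₁, he₁, e₂, he₂, rfl⟩ := exists_eq_mul_transversals_mul γ
  have hsh : transversals s h = transversals (Function.Embedding.refl X) f *
      transversals (s.trans f) (h.trans g) * transversals g (Function.Embedding.refl X) := by
    rw [transversals_mul, transversals_mul']
    rfl
  rw [hsh]
  refine mul_mem (mul_mem (hE he₁) (mul_mem (mul_mem hfS (hE (transversals_mem ?_ ?_))) hgS))
    (hE he₂)
  · exact large s f (hf ▸ hα')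
  · exact large h g (hg ▸ hβ')

theorem exists_embedding_compl_range (X : Type u) [Infinite X] :
    ∃ f : X ↪ X, #((Set.range f)ᶜ : Set X) = #X := by
  obtain ⟨s, t, -, -, hst⟩ :=
    exists_two_embeddings (Function.Embedding.refl X) (Cardinal.mk_univ (α := X))
  refine ⟨s, le_antisymm (Cardinal.mk_set_le _) ?_⟩
  rw [← Cardinal.mk_range_eq t t.injective]
  refine Cardinal.mk_le_mk_of_subset ?_
  rintro _ ⟨i, rfl⟩ ⟨j, hj⟩
  exact hst j i hj

theorem exists_mem_rightUnits_codefect_eq (X : Type u) [Infinite X] :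
    ∃ ρ ∈ rightUnits (PartialBrauer X), ρ.codefect = #X := by
  obtain ⟨f, hf⟩ := exists_embedding_compl_range X
  refine ⟨transversals (Function.Embedding.refl X) f,
    ⟨transversals f (Function.Embedding.refl X), ?_⟩, ?_⟩
  · rw [transversals_mul_transversals, transversals_refl]
  · rw [codefect, codom_transversals, hf]

theorem codefect_one_ne : (1 : PartialBrauer X).codefect ≠ #X := by
  rw [codefect_eq_zero_of_mem_leftUnits ⟨1, one_mul 1⟩]
  exact (Cardinal.mk_ne_zero X).symm

/-- Along the partial products of a factorization of a right unit, an idempotent factor cannot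
raise a codefect below `#X` to `#X`: its defect, hence also its codefect, is small. -/
theorem exists_codefect_eq_of_closure_eq_top {S : Set (PartialBrauer X)}
    (h : Subsemigroup.closure
      ((idempotentGenerated (PartialBrauer X) : Set (PartialBrauer X)) ∪ S) = ⊤) :
    ∃ x ∈ S, x.codefect = #X ∧ x.defect < #X := by
  by_contra! hn
  let P : PartialBrauer X → Prop := fun m => ∀ r : PartialBrauer X, r.codefect < #X →
    r * m ∈ rightUnits (PartialBrauer X) → (r * m).codefect < #X
  have hmul : ∀ a b, P a → P b → P (a * b) := by
    intro a b ha hb r hr hrm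
    rw [← mul_assoc] at hrm ⊢
    exact hb _ (ha r hr (mem_rightUnits_of_mul hrm)) hrm
  have hadd : ∀ {a b : Cardinal.{u}}, a < #X → b < #X → a + b < #X :=
    Cardinal.add_lt_of_lt (Cardinal.aleph0_le_mk X)
  have hP : ∀ m ∈ Subsemigroup.closure
      ((idempotentGenerated (PartialBrauer X) : Set (PartialBrauer X)) ∪ S), P m := by
    intro m hm
    induction hm using Subsemigroup.closure_induction with
    | mem m hm =>
      rcases hm with hm | hm
      · induction hm using Subsemigroup.closure_induction with
        | mem e he =>
          intro r hr hre
          refine (codefect_mul_le r e).trans_lt (hadd ?_ hr)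
          rw [← defect_eq_codefect_of_isIdempotentElem he]
          exact (defect_le_of_mul_mem_rightUnits hre).trans_lt (hadd hr hr)
        | mul a b _ _ ha hb => exact hmul a b ha hb
      · intro r hr hrm
        refine (codefect_mul_le r m).trans_lt (hadd ?_ hr)
        refine lt_of_le_of_ne (Cardinal.mk_set_le _) fun hc => ?_
        exact absurd ((defect_le_of_mul_mem_rightUnits hrm).trans_lt (hadd hr hr))
          (not_lt.2 (hn m hm hc))
    | mul a b _ _ ha hb => exact hmul a b ha hb
  obtain ⟨ρ, hρ, hρ'⟩ := exists_mem_rightUnits_codefect_eq X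
  have := hP ρ (h ▸ Subsemigroup.mem_top _) 1
    (lt_of_le_of_ne (Cardinal.mk_set_le _) codefect_one_ne) (by rwa [one_mul])
  rw [one_mul] at this
  exact this.ne hρ'

/-- The first factor other than `1` in a factorization of a right unit is a right unit, and it is
not idempotent. -/
theorem exists_mem_rightUnits_of_closure_eq_top {S : Set (PartialBrauer X)}
    (h : Subsemigroup.closure
      ((idempotentGenerated (PartialBrauer X) : Set (PartialBrauer X)) ∪ S) = ⊤) :
    ∃ x ∈ S, x ∈ rightUnits (PartialBrauer X) := by
  by_contra! hn
  let P : PartialBrauer X → Prop := fun m => m ∈ rightUnits (PartialBrauer X) → m = 1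
  have hmul : ∀ a b, P a → P b → P (a * b) := by
    intro a b ha hb hab
    obtain rfl := ha (mem_rightUnits_of_mul hab)
    rw [one_mul] at hab ⊢
    exact hb hab
  have hP : ∀ m ∈ Subsemigroup.closure
      ((idempotentGenerated (PartialBrauer X) : Set (PartialBrauer X)) ∪ S), P m := by
    intro m hm
    induction hm using Subsemigroup.closure_induction with
    | mem m hm =>
      rcases hm with hm | hm
      · induction hm using Subsemigroup.closure_induction with
        | mem e he => exact eq_one_of_isIdempotentElem he
        | mul a b _ _ ha hb => exact hmul a b ha hb
      · exact fun hr => absurd hr (hn m hm)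
    | mul a b _ _ ha hb => exact hmul a b ha hb
  obtain ⟨ρ, hρ, hρ'⟩ := exists_mem_rightUnits_codefect_eq X
  rw [hP ρ (h ▸ Subsemigroup.mem_top _) hρ] at hρ'
  exact codefect_one_ne hρ'

theorem closure_eq_top_iff (α β : PartialBrauer X) :
    Subsemigroup.closure
        ((idempotentGenerated (PartialBrauer X) : Set (PartialBrauer X)) ∪ {α, β}) = ⊤ ↔
      (α ∈ rightUnits (PartialBrauer X) ∧ β ∈ leftUnits (PartialBrauer X) ∧
          α.codefect = #X ∧ β.defect = #X) ∨
      (β ∈ rightUnits (PartialBrauer X) ∧ α ∈ leftUnits (PartialBrauer X) ∧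
          β.codefect = #X ∧ α.defect = #X) := by
  constructor
  · intro h
    have h' := closure_flip_eq_top h
    obtain ⟨a, ha, ha1, ha2⟩ := exists_codefect_eq_of_closure_eq_top h
    obtain ⟨c, hc, hc1⟩ := exists_mem_rightUnits_of_closure_eq_top h
    obtain ⟨_, ⟨b, hb, rfl⟩, hb1, hb2⟩ := exists_codefect_eq_of_closure_eq_top h'
    obtain ⟨_, ⟨d, hd, rfl⟩, hd1⟩ := exists_mem_rightUnits_of_closure_eq_top h'
    replace hd1 := flip_mem_leftUnits hd1
    rw [flip_flip] at hd1
    rw [codefect_flip] at hb1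
    have hab : a ≠ b := by
      rintro rfl
      exact ha2.ne hb1
    have hcb : c ≠ b := by
      rintro rfl
      exact Cardinal.mk_ne_zero X (hb1.symm.trans (defect_eq_zero_of_mem_rightUnits hc1))
    have hda : d ≠ a := by
      rintro rfl
      exact Cardinal.mk_ne_zero X (ha1.symm.trans (codefect_eq_zero_of_mem_leftUnits hd1))
    rcases ha with rfl | rfl <;> rcases hb with rfl | rfl <;> rcases hc with rfl | rfl <;>
      rcases hd with rfl | rfl <;>
      first
      | exact absurd rfl hab
      | exact absurd rfl hcb
      | exact absurd rfl hda
      | exact Or.inl ⟨hc1, hd1, ha1, hb1⟩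
      | exact Or.inr ⟨hc1, hd1, ha1, hb1⟩
  · rintro (⟨h1, h2, h3, h4⟩ | ⟨h1, h2, h3, h4⟩)
    · exact closure_eq_top h1 h2 h3 h4
    · rw [Set.pair_comm]
      exact closure_eq_top h1 h2 h3 h4

/-- A single element does not generate modulo the idempotents, as it would be a left and a right
unit, of codefect both `0` and `#X`. -/
theorem closure_singleton_ne_top (α : PartialBrauer X) :
    Subsemigroup.closure
      ((idempotentGenerated (PartialBrauer X) : Set (PartialBrauer X)) ∪ {α}) ≠ ⊤ := by
  intro h
  rw [← Set.pair_eq_singleton, closure_eq_top_iff, or_self] at h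
  obtain ⟨_, h2, h3, _⟩ := h
  exact Cardinal.mk_ne_zero X (h3.symm.trans (codefect_eq_zero_of_mem_leftUnits h2))

theorem relRank_idempotentGenerated (X : Type u) [Infinite X] :
    relRank (PartialBrauer X)
      (idempotentGenerated (PartialBrauer X) : Set (PartialBrauer X)) = 2 := by
  have two_le : ∀ U : Set (PartialBrauer X), Subsemigroup.closure
      ((idempotentGenerated (PartialBrauer X) : Set (PartialBrauer X)) ∪ U) = ⊤ → 2 ≤ #U := by
    intro U hU
    rw [Cardinal.two_le_iff_one_lt]
    by_contra! hle
    rw [Cardinal.mk_le_one_iff_set_subsingleton] at hle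
    rcases hle.eq_empty_or_singleton with rfl | ⟨α, rfl⟩
    · refine closure_singleton_ne_top (1 : PartialBrauer X) (top_unique (hU ▸ ?_))
      exact Subsemigroup.closure_mono (Set.union_subset_union_right _ (Set.empty_subset _))
    · exact closure_singleton_ne_top α hU
  obtain ⟨ρ, hρ, hρ'⟩ := exists_mem_rightUnits_codefect_eq X
  have hgen := closure_eq_top hρ (flip_mem_leftUnits hρ) hρ' ((defect_flip ρ).trans hρ')
  refine le_antisymm ?_ (le_csInf ⟨_, ⟨_, hgen, rfl⟩⟩ ?_)
  · have hle : #({ρ, ρ.flip} : Set (PartialBrauer X)) ≤ 2 := by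
      refine Cardinal.mk_insert_le.trans ?_
      rw [Cardinal.mk_singleton, one_add_one_eq_two]
    exact le_trans (csInf_le' ⟨_, hgen, rfl⟩) hle
  · rintro _ ⟨U, hU, rfl⟩
    exact two_le U hU

end

end PartialBrauer

theorem theorem5 (X : Type u) [Infinite X] :
    relRank (PartialBrauer X) (idempotentGenerated (PartialBrauer X) : Set (PartialBrauer X)) = 2 ∧
    ∀ α β : PartialBrauer X,
      Subsemigroup.closure
          ((idempotentGenerated (PartialBrauer X) : Set (PartialBrauer X)) ∪ {α, β}) = ⊤ ↔
        (α ∈ rightUnits (PartialBrauer X) ∧ β ∈ leftUnits (PartialBrauer X) ∧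
            α.codefect = #X ∧ β.defect = #X) ∨
        (β ∈ rightUnits (PartialBrauer X) ∧ α ∈ leftUnits (PartialBrauer X) ∧
            β.codefect = #X ∧ α.defect = #X) := by
  exact ⟨PartialBrauer.relRank_idempotentGenerated X, PartialBrauer.closure_eq_top_iff⟩
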